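/- Let $\delta\in(0,1)$, $k=\lceil 200\log(2/\delta)\rceil$, and let $n=mk$ with $m\ge 1$ an integer. Let $X_1,\dots,X_n$ be i.i.d. random vectors in $\mathbb{R}^d$ with $\mathbb{E}\|X_1\|^2<\infty$, mean $\mu$ and covariance matrix $\Sigma$, whose largest eigenvalue is $\lambda_{\max}$; here $\|\cdot\|$ is the Euclidean norm. Let $B_1,\dots,B_k$ be a (deterministic) partition of $\{1,\dots,n\}$ into $k$ disjoint blocks of $m$ elements each, let $Z_j=\frac1m\sum_{i\in B_j}X_i$, and set $$r=\max\left(960\sqrt{\frac{\mathrm{Tr}(\Sigma)}{n}},\ 240\sqrt{\frac{\lambda_{\max}\log(2/\delta)}{n}}\right).$$ Say that $a\in\mathbb{R}^d$ defeats $b\in\mathbb{R}^d$ if $\frac1m\sum_{i\in B_j}\left(\|X_i-b\|^2-\|X_i-a\|^2\right)>0$ for more than $k/2$ of the indices $j$, and let $$T_\mu=\left\{x\in\mathbb{R}^d:\ \exists J\subset\{1,\dots,k\},\ |J|\ge k/2,\ \|Z_j-x\|\le\|Z_j-\mu\|\ \text{for all } j\in J\right\}.$$ Then with probability at least $1-\delta$,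 simultaneously for every $a\in\mathbb{R}^d$ with $a\ne\mu$ and $\|a-\mu\|\ge r$, the following hold: $\|Z_j-a\|>\|Z_j-\mu\|$ for more than $k/2$ of the indices $j$; $\mu$ defeats $a$; and $a\notin T_\mu$. Moreover, for every $a\in\mathbb{R}^d$ and every outcome, these three properties of $a$ are equivalent. (The requirement $a\ne\mu$ matters only if $\Sigma=0$, since otherwise $r>0$.) -/

import Mathlib

open MeasureTheory ProbabilityTheory

namespace MomTournament

noncomputable section

/-- Mean vector of a law `ν` on `ℝ^d`. -/
def meanVec {d : ℕ} (ν : Measure (EuclideanSpace ℝ (Fin d))) : EuclideanSpace ℝ (Fin d) :=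
  ∫ x, x ∂ν

/-- Covariance matrix `E (X - μ) (X - μ)ᵀ` of a law `ν` on `ℝ^d`, where `μ = E X`. -/
def covMat {d : ℕ} (ν : Measure (EuclideanSpace ℝ (Fin d))) : Matrix (Fin d) (Fin d) ℝ :=
  Matrix.of fun p q => ∫ x, (x p - meanVec ν p) * (x q - meanVec ν q) ∂ν

/-- Largest eigenvalue of a real symmetric matrix (for `d = 0` this is `0`). -/
def lambdaMax {d : ℕ} (A : Matrix (Fin d) (Fin d) ℝ) : ℝ :=
  sSup {l : ℝ | Module.End.HasEigenvalue (Matrix.toLin' A) l}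

/-- The tournament radius. -/
def radius {d : ℕ} (ν : Measure (EuclideanSpace ℝ (Fin d))) (n : ℕ) (δ : ℝ) : ℝ :=
  max (960 * √((covMat ν).trace / n))
    (240 * √(lambdaMax (covMat ν) * Real.log (2 / δ) / n))

/-- `B` partitions the `n` indices into `k` disjoint blocks, each with `m` elements. -/
structure IsBlockPartition {n k : ℕ} (m : ℕ) (B : Fin k → Finset (Fin n)) : Prop where
  disjoint : Pairwise fun i j => Disjoint (B i) (B j)
  cover : ∀ i, ∃ j, i ∈ B j
  card_eq : ∀ j, (B j).card = m

/-- The sample mean `Z_j` of the data `x` within the block `B j`. -/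
def blockMean {d n k : ℕ} (m : ℕ) (B : Fin k → Finset (Fin n))
    (x : Fin n → EuclideanSpace ℝ (Fin d)) (j : Fin k) : EuclideanSpace ℝ (Fin d) :=
  (1 / (m : ℝ)) • ∑ i ∈ B j, x i

/-- The set `T_a` determined by the points `Z_1, …, Z_k`: the points `x` that are at least as
close as `a` to at least half of the `Z_j`. -/
def closerSet {d k : ℕ} (Z : Fin k → EuclideanSpace ℝ (Fin d)) (a : EuclideanSpace ℝ (Fin d)) :
    Set (EuclideanSpace ℝ (Fin d)) :=
  {x | ∃ J : Finset (Fin k), (k : ℝ) / 2 ≤ (J.card : ℝ) ∧ ∀ j ∈ J, ‖Z j - x‖ ≤ ‖Z j - a‖}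

open Classical in
/-- `a` defeats `b`: the average of `‖x_i - b‖² - ‖x_i - a‖²` is positive on more than `k/2`
blocks. -/
def Defeats {d n k : ℕ} (m : ℕ) (B : Fin k → Finset (Fin n))
    (x : Fin n → EuclideanSpace ℝ (Fin d)) (a b : EuclideanSpace ℝ (Fin d)) : Prop :=
  (k : ℝ) / 2 <
    ((Finset.univ.filter fun j : Fin k =>
      0 < (1 / (m : ℝ)) * ∑ i ∈ B j, (‖x i - b‖ ^ 2 - ‖x i - a‖ ^ 2)).card : ℝ)

open Classical in
/-- `b` is strictly closer than `a` to more than `k/2` of the points `Z_1, …, Z_k`. -/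
def CloserToMajority {d k : ℕ} (Z : Fin k → EuclideanSpace ℝ (Fin d))
    (b a : EuclideanSpace ℝ (Fin d)) : Prop :=
  (k : ℝ) / 2 < ((Finset.univ.filter fun j : Fin k => ‖Z j - b‖ < ‖Z j - a‖).card : ℝ)

end

end MomTournament

/-!
Write `μ` for the mean, `Z j` for the block means and `Tr`, `λ` for the trace and the largest
eigenvalue of the covariance matrix. Expanding `‖Z j - a‖²` around `μ` shows that `a` can be at
least as close to `Z j` as `μ` is only if `⟪Z j - μ, v⟫ ≥ ‖a - μ‖ / 2`, where `v` is the unit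
vector in the direction `a - μ`. So it is enough to find an event of probability `1 - δ` on which,
for all unit vectors `v` at once, fewer than `k / 2` of the `Z j - μ` have a component of at least
`r / 2` along `v`.

The uniformity in `v` comes from a Gaussian change of measure (a PAC-Bayesian argument), which
replaces covering numbers, symmetrization and bounded differences. Let `N θ` be the number of `j`
with `⟪Z j - μ, θ⟫ ≥ ρ`, and let `p θ` be `2 k` times the Chebyshev bound for one block.

* For fixed `θ`, independence of the blocks and `e - 1 ≤ 2` give `E exp (N θ - p θ) ≤ 1`
  (`integral_exp_exceedances_le`). Averaging over a standard Gaussian `θ` and applying Markov's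
  inequality, `∫ exp (N θ - p θ) < 1 / δ` off an event of probability `δ`.
* Shifting the Gaussian by an arbitrary `v` and applying Jensen's inequality
  (`exp_integral_comp_add_sub_le_integral_exp`) turns this single bound into
  `∫ (N (v + ξ) - p (v + ξ)) < ‖v‖² / 2 + log (1 / δ)` for every `v` simultaneously.
* Since `⟪Z j - μ, ξ⟫ ≥ 0` with probability at least `1 / 2`, the average of `N (v + ξ)` is at
  least `N v / 2`, while the average of `p (v + ξ)` is governed by the variance along `v` plus `Tr`.

Applied to `v` of length `√(k / 10)` and to `ρ = √(k / 10) * r / 2`, the definition of `r` makes the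
right-hand side smaller than `k / 4`. If `r = 0`, then `Tr = 0` and all data equal `μ` almost surely.
-/

open scoped RealInnerProductSpace

/-! ### Shifts and quadratic averages of the standard Gaussian -/

/-- The joint Laplace and Fourier transform of the standard Gaussian: it factors over the
coordinates, where it is the complex moment generating function of `N(0, 1)`. -/
theorem Complex.integral_exp_inner_stdGaussian {ι : Type*} [Fintype ι]
    (v t : EuclideanSpace ℝ ι) :
    ∫ x, Complex.exp (⟪v, x⟫ + ⟪x, t⟫ * Complex.I) ∂(stdGaussian (EuclideanSpace ℝ ι)) =
      Complex.exp (∑ i, ((v i : ℂ) + t i * Complex.I) ^ 2 / 2) := by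
  rw [← map_pi_eq_stdGaussian, integral_map (by fun_prop)
    (Measurable.aestronglyMeasurable (by fun_prop))]
  have h : ∀ x : ι → ℝ, Complex.exp (⟪v, WithLp.toLp 2 x⟫ + ⟪WithLp.toLp 2 x, t⟫ * Complex.I) =
      ∏ i, Complex.exp (((v i : ℂ) + t i * Complex.I) * x i) := by
    intro x
    rw [← Complex.exp_sum]
    congr 1
    simp only [PiLp.inner_apply, RCLike.inner_apply, conj_trivial, Complex.ofReal_sum,
      Complex.ofReal_mul, Finset.sum_mul, ← Finset.sum_add_distrib]
    exact Finset.sum_congr rfl fun i _ => by ring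
  simp_rw [h]
  rw [integral_fintype_prod_eq_prod
    (f := fun i (x : ℝ) => Complex.exp (((v i : ℂ) + t i * Complex.I) * x)), Complex.exp_sum]
  refine Finset.prod_congr rfl fun i _ => ?_
  have := complexMGF_id_gaussianReal (μ := 0) (v := 1) ((v i : ℂ) + t i * Complex.I)
  simpa [complexMGF] using this

theorem integrable_exp_inner_stdGaussian {ι : Type*} [Fintype ι] (v : EuclideanSpace ℝ ι) :
    Integrable (fun x => Real.exp ⟪v, x⟫) (stdGaussian (EuclideanSpace ℝ ι)) := by
  have h := Complex.integral_exp_inner_stdGaussian v 0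
  have h' : Integrable (fun x => Complex.exp (⟪v, x⟫ + ⟪x, (0 : EuclideanSpace ℝ ι)⟫ * Complex.I))
      (stdGaussian (EuclideanSpace ℝ ι)) := by
    -- A Bochner integral that is nonzero can only come from an integrable function.
    by_contra hn
    rw [integral_undef hn] at h
    exact Complex.exp_ne_zero _ h.symm
  refine h'.norm.congr (.of_forall fun x => ?_)
  simp [Complex.norm_exp]

/-- The Cameron–Martin formula in finite dimension, by comparison of characteristic functions. -/
theorem stdGaussian_map_add_left {ι : Type*} [Fintype ι] (v : EuclideanSpace ℝ ι) :
    (stdGaussian (EuclideanSpace ℝ ι)).map (fun x => v + x) =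
      (stdGaussian (EuclideanSpace ℝ ι)).withDensity
        fun x => ENNReal.ofReal (Real.exp (⟪v, x⟫ - ‖v‖ ^ 2 / 2)) := by
  have hint : Integrable (fun x => Real.exp (⟪v, x⟫ - ‖v‖ ^ 2 / 2))
      (stdGaussian (EuclideanSpace ℝ ι)) := by
    simp_rw [Real.exp_sub]
    exact (integrable_exp_inner_stdGaussian v).div_const _
  have := isFiniteMeasure_withDensity_ofReal hint.2
  apply Measure.ext_of_charFun
  ext t
  rw [charFun_apply, charFun_apply, integral_map (by fun_prop)
    (Measurable.aestronglyMeasurable (by fun_prop)), integral_withDensity_eq_integral_toReal_smul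
    (by fun_prop) (by simp)]
  have h1 : ∀ x : EuclideanSpace ℝ ι, Complex.exp (⟪v + x, t⟫ * Complex.I) =
      Complex.exp (⟪v, t⟫ * Complex.I) * Complex.exp (⟪x, t⟫ * Complex.I) := by
    intro x
    rw [← Complex.exp_add, inner_add_left]
    push_cast
    ring_nf
  have h2 : ∀ x : EuclideanSpace ℝ ι,
      (ENNReal.ofReal (Real.exp (⟪v, x⟫ - ‖v‖ ^ 2 / 2))).toReal •
        Complex.exp (⟪x, t⟫ * Complex.I) =
      Complex.exp (-(‖v‖ ^ 2 / 2 : ℝ)) * Complex.exp (⟪v, x⟫ + ⟪x, t⟫ * Complex.I) := by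
    intro x
    rw [ENNReal.toReal_ofReal (Real.exp_nonneg _), Complex.real_smul, Complex.ofReal_exp,
      ← Complex.exp_add, ← Complex.exp_add]
    push_cast
    ring_nf
  simp_rw [h1, h2, integral_const_mul]
  rw [Complex.integral_exp_inner_stdGaussian]
  have h3 := charFun_stdGaussian (E := EuclideanSpace ℝ ι) t
  rw [charFun_apply] at h3
  rw [h3, ← Complex.exp_add, ← Complex.exp_add]
  congr 1
  rw [← Complex.ofReal_pow, EuclideanSpace.real_norm_sq_eq, EuclideanSpace.real_norm_sq_eq,
    PiLp.inner_apply]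
  simp only [RCLike.inner_apply, conj_trivial]
  push_cast
  rw [Finset.sum_mul, ← Finset.sum_neg_distrib, Finset.sum_div, Finset.sum_div,
    ← Finset.sum_neg_distrib, ← Finset.sum_add_distrib, ← Finset.sum_add_distrib]
  refine Finset.sum_congr rfl fun i _ => ?_
  ring_nf
  rw [Complex.I_sq]
  ring

/-- The variational bound behind the uniformity in the direction: one exponential moment under the
Gaussian controls the average of `h` under every translate of it, at the cost `‖v‖ ^ 2 / 2`, which
is the relative entropy between the two measures. -/
theorem exp_integral_comp_add_sub_le_integral_exp {ι : Type*} [Fintype ι]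
    {h : EuclideanSpace ℝ ι → ℝ} (v : EuclideanSpace ℝ ι)
    (hexp : Integrable (fun x => Real.exp (h x)) (stdGaussian (EuclideanSpace ℝ ι)))
    (hint : Integrable (fun x => h (v + x)) (stdGaussian (EuclideanSpace ℝ ι))) :
    Real.exp (∫ x, h (v + x) ∂(stdGaussian (EuclideanSpace ℝ ι)) - ‖v‖ ^ 2 / 2) ≤
      ∫ x, Real.exp (h x) ∂(stdGaussian (EuclideanSpace ℝ ι)) := by
  set γ := stdGaussian (EuclideanSpace ℝ ι)
  have hL : Integrable (fun x : EuclideanSpace ℝ ι => ⟪v, x⟫) γ :=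
    (IsGaussian.integrable_dual γ (innerSL ℝ v)).congr (.of_forall fun x => by simp)
  have hL0 : ∫ x, ⟪v, x⟫ ∂γ = 0 := by
    simpa using integral_strongDual_stdGaussian (innerSL ℝ v)
  set g : EuclideanSpace ℝ ι → ℝ := fun x => Real.exp (h x - (⟪v, x⟫ - ‖v‖ ^ 2 / 2))
  have hmul : ∀ x, (ENNReal.ofReal (Real.exp (⟪v, x⟫ - ‖v‖ ^ 2 / 2))).toReal • g x =
      Real.exp (h x) := by
    intro x
    rw [ENNReal.toReal_ofReal (Real.exp_nonneg _), smul_eq_mul, ← Real.exp_add]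
    congr 1
    ring
  have hemb : MeasurableEmbedding fun x : EuclideanSpace ℝ ι => v + x :=
    measurableEmbedding_addLeft v
  have hgint : Integrable (fun x => g (v + x)) γ := by
    have : Integrable g (γ.map fun x => v + x) := by
      rw [stdGaussian_map_add_left, integrable_withDensity_iff_integrable_smul' (by fun_prop)
        (by simp)]
      exact hexp.congr (.of_forall fun x => (hmul x).symm)
    exact hemb.integrable_map_iff.1 this
  have hgeq : ∫ x, Real.exp (h x) ∂γ = ∫ x, g (v + x) ∂γ := by
    rw [← hemb.integral_map, stdGaussian_map_add_left,
      integral_withDensity_eq_integral_toReal_smul (by fun_prop) (by simp)]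
    simp_rw [hmul]
    rfl
  have hexpo : ∀ x, g (v + x) = Real.exp (h (v + x) - (⟪v, x⟫ + ‖v‖ ^ 2 / 2)) := by
    intro x
    simp only [g]
    rw [inner_add_right, real_inner_self_eq_norm_sq]
    congr 1
    ring
  -- Under the translate, the linear part `⟪v, x⟫` of the exponent averages to zero.
  have hjen := convexOn_exp.map_integral_le (μ := γ)
    (f := fun x => h (v + x) - (⟪v, x⟫ + ‖v‖ ^ 2 / 2)) Real.continuous_exp.continuousOn
    isClosed_univ (by simp) (hint.sub (hL.add (integrable_const _)))
    (hgint.congr (.of_forall hexpo))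
  have hLc : Integrable (fun x => ⟪v, x⟫ + ‖v‖ ^ 2 / 2) γ := hL.add (integrable_const _)
  rw [integral_sub hint hLc, integral_add hL (integrable_const _), hL0] at hjen
  rw [hgeq]
  simp_rw [hexpo]
  simpa using hjen

theorem stdGaussian_map_neg {ι : Type*} [Fintype ι] :
    (stdGaussian (EuclideanSpace ℝ ι)).map (fun x => -x) = stdGaussian (EuclideanSpace ℝ ι) :=
  stdGaussian_map (LinearIsometryEquiv.neg ℝ (E := EuclideanSpace ℝ ι))

theorem half_le_stdGaussian_halfSpace {ι : Type*} [Fintype ι] (u : EuclideanSpace ℝ ι) :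
    1 / 2 ≤ (stdGaussian (EuclideanSpace ℝ ι)).real {x | 0 ≤ ⟪u, x⟫} := by
  set γ := stdGaussian (EuclideanSpace ℝ ι)
  have hm : MeasurableSet {x : EuclideanSpace ℝ ι | 0 ≤ ⟪u, x⟫} :=
    measurableSet_le (by fun_prop) (by fun_prop)
  have h1 : γ.real {x | 0 ≤ ⟪u, -x⟫} = γ.real {x | 0 ≤ ⟪u, x⟫} := by
    have h := map_measureReal_apply (μ := γ) measurable_neg hm
    rw [stdGaussian_map_neg] at h
    exact h.symm
  have h2 : γ.real Set.univ ≤ γ.real {x | 0 ≤ ⟪u, x⟫} + γ.real {x | 0 ≤ ⟪u, -x⟫} := by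
    refine le_trans (measureReal_mono fun x _ => ?_) (measureReal_union_le _ _)
    rcases le_total 0 ⟪u, x⟫ with h | h
    · exact Or.inl h
    · exact Or.inr (by simpa using h)
  rw [h1, probReal_univ] at h2
  linarith

theorem integrable_bilin_stdGaussian {ι : Type*} [Fintype ι]
    (M : EuclideanSpace ℝ ι →L[ℝ] EuclideanSpace ℝ ι →L[ℝ] ℝ) :
    Integrable (fun x => M x x) (stdGaussian (EuclideanSpace ℝ ι)) := by
  have h2 : MemLp id 2 (stdGaussian (EuclideanSpace ℝ ι)) := IsGaussian.memLp_two_id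
  refine (h2.integrable_norm_pow (by norm_num)).const_mul ‖M‖ |>.mono'
    (Continuous.aestronglyMeasurable (by fun_prop)) (.of_forall fun x => ?_)
  simpa [pow_two, mul_assoc] using M.le_opNorm₂ x x

theorem integral_bilin_stdGaussian {ι : Type*} [Fintype ι]
    (M : EuclideanSpace ℝ ι →L[ℝ] EuclideanSpace ℝ ι →L[ℝ] ℝ) :
    ∫ x, M x x ∂(stdGaussian (EuclideanSpace ℝ ι)) =
      ∑ i, M (EuclideanSpace.basisFun ι ℝ i) (EuclideanSpace.basisFun ι ℝ i) := by
  classical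
  set γ := stdGaussian (EuclideanSpace ℝ ι)
  set e := EuclideanSpace.basisFun ι ℝ
  have h2 : MemLp id 2 γ := IsGaussian.memLp_two_id
  have hcov : ∀ p q, ∫ x, ⟪e p, x⟫ * ⟪e q, x⟫ ∂γ = ⟪e p, e q⟫ := by
    intro p q
    have h := covarianceBilin_apply h2 (e p) (e q)
    rw [covarianceBilin_stdGaussian, innerSL_apply_apply] at h
    rw [h]
    simp [γ]
  have hx : ∀ x, M x x = ∑ p, ∑ q, ⟪e p, x⟫ * ⟪e q, x⟫ * M (e p) (e q) := by
    intro x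
    conv_lhs => rw [← e.sum_repr' x]
    simp only [map_sum, map_smul, sum_apply, smul_apply,
      smul_eq_mul, Finset.mul_sum]
    rw [Finset.sum_comm]
    exact Finset.sum_congr rfl fun p _ => Finset.sum_congr rfl fun q _ => by ring
  have hint : ∀ p q, Integrable (fun x => ⟪e p, x⟫ * ⟪e q, x⟫ * M (e p) (e q)) γ := fun p q =>
    ((h2.const_inner (e p)).integrable_mul (h2.const_inner (e q))).mul_const _
  simp_rw [hx]
  rw [integral_finsetSum _ fun p _ => integrable_finsetSum _ fun q _ => hint p q]
  refine Finset.sum_congr rfl fun p _ => ?_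
  rw [integral_finsetSum _ fun q _ => hint p q]
  simp_rw [integral_mul_const, hcov, e.inner_eq_ite]
  simp

theorem integrable_and_integral_bilin_add_left_stdGaussian {ι : Type*} [Fintype ι]
    (M : EuclideanSpace ℝ ι →L[ℝ] EuclideanSpace ℝ ι →L[ℝ] ℝ) (v : EuclideanSpace ℝ ι) :
    Integrable (fun x => M (v + x) (v + x)) (stdGaussian (EuclideanSpace ℝ ι)) ∧
      ∫ x, M (v + x) (v + x) ∂(stdGaussian (EuclideanSpace ℝ ι)) =
      M v v + ∑ i, M (EuclideanSpace.basisFun ι ℝ i) (EuclideanSpace.basisFun ι ℝ i) := by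
  set γ := stdGaussian (EuclideanSpace ℝ ι)
  have h1 : Integrable (fun x => (M v + M.flip v) x) γ := IsGaussian.integrable_dual γ _
  have h2 := integrable_bilin_stdGaussian M
  have h0 : ∫ x, (M v + M.flip v) x ∂γ = 0 := integral_strongDual_stdGaussian _
  have he : ∀ x, M (v + x) (v + x) = M v v + (M v + M.flip v) x + M x x := by
    intro x
    simp
    ring
  simp_rw [he]
  have h3 : Integrable (fun x => M v v + (M v + M.flip v) x) γ := (integrable_const _).add h1
  refine ⟨h3.add h2, ?_⟩
  rw [integral_add h3 h2, integral_add (integrable_const _) h1, h0,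
    integral_bilin_stdGaussian]
  simp

/-! ### Mean, covariance and the largest eigenvalue -/

namespace MomTournament

/-- The number of vectors `U j` whose component along `θ` is at least `ρ`, as a real number. -/
noncomputable def exceedances {d k : ℕ} (U : Fin k → EuclideanSpace ℝ (Fin d)) (ρ : ℝ)
    (θ : EuclideanSpace ℝ (Fin d)) : ℝ :=
  ∑ j, if ρ ≤ ⟪U j, θ⟫ then 1 else 0

theorem covMat_apply_eq_covarianceBilin {d : ℕ} {ν : Measure (EuclideanSpace ℝ (Fin d))}
    [IsProbabilityMeasure ν] (hν : MemLp id 2 ν) (p q : Fin d) :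
    covMat ν p q = covarianceBilin ν (EuclideanSpace.basisFun (Fin d) ℝ p)
      (EuclideanSpace.basisFun (Fin d) ℝ q) := by
  rw [covarianceBilin_apply hν]
  simp [covMat, meanVec, EuclideanSpace.inner_single_left]

theorem trace_covMat {d : ℕ} {ν : Measure (EuclideanSpace ℝ (Fin d))}
    [IsProbabilityMeasure ν] (hν : MemLp id 2 ν) :
    (covMat ν).trace = ∑ p, covarianceBilin ν (EuclideanSpace.basisFun (Fin d) ℝ p)
      (EuclideanSpace.basisFun (Fin d) ℝ p) := by
  simp only [Matrix.trace, Matrix.diag_apply, covMat_apply_eq_covarianceBilin hν]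

theorem covarianceBilin_eq_dotProduct {d : ℕ} {ν : Measure (EuclideanSpace ℝ (Fin d))}
    [IsProbabilityMeasure ν] (hν : MemLp id 2 ν) (v : EuclideanSpace ℝ (Fin d)) :
    covarianceBilin ν v v = v.ofLp ⬝ᵥ (covMat ν).mulVec v.ofLp := by
  conv_lhs => rw [← (EuclideanSpace.basisFun (Fin d) ℝ).sum_repr v]
  simp only [map_sum, map_smul, sum_apply, smul_apply,
    smul_eq_mul, ← covMat_apply_eq_covarianceBilin hν, dotProduct, Matrix.mulVec,
    EuclideanSpace.basisFun_repr]
  simp only [Finset.mul_sum]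
  rw [Finset.sum_comm]
  exact Finset.sum_congr rfl fun p _ => Finset.sum_congr rfl fun q _ => by ring

/-- The Rayleigh bound. The supremum defining `lambdaMax` is over a finite set of eigenvalues, and
`lambdaMax A - A` is positive semidefinite because its spectrum is nonnegative. -/
theorem dotProduct_mulVec_le_lambdaMax {d : ℕ} {A : Matrix (Fin d) (Fin d) ℝ}
    (hA : A.IsHermitian) (v : Fin d → ℝ) :
    v ⬝ᵥ A.mulVec v ≤ lambdaMax A * (v ⬝ᵥ v) := by
  have hbdd : BddAbove {l : ℝ | Module.End.HasEigenvalue (Matrix.toLin' A) l} := by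
    refine Set.Finite.bddAbove ?_
    exact Module.End.finite_hasEigenvalue _
  have hpsd : (algebraMap ℝ (Matrix (Fin d) (Fin d) ℝ) (lambdaMax A) - A).PosSemidef := by
    rw [Matrix.posSemidef_iff_isHermitian_and_spectrum_nonneg]
    refine ⟨?_, ?_⟩
    · rw [Matrix.algebraMap_eq_diagonal]
      exact (Matrix.isHermitian_diagonal _).sub hA
    · rw [← spectrum.singleton_sub_eq]
      rintro _ ⟨_, rfl, l, hl, rfl⟩
      have : Module.End.HasEigenvalue (Matrix.toLin' A) l := by
        rw [Module.End.hasEigenvalue_iff_mem_spectrum, Matrix.spectrum_toLin']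
        exact hl
      exact sub_nonneg.2 (le_csSup hbdd this)
  have h := hpsd.dotProduct_mulVec_nonneg v
  rw [Algebra.algebraMap_eq_smul_one, Matrix.sub_mulVec, Matrix.smul_mulVec, Matrix.one_mulVec,
    dotProduct_sub, dotProduct_smul] at h
  simpa using h

theorem covarianceBilin_self_le_lambdaMax {d : ℕ} {ν : Measure (EuclideanSpace ℝ (Fin d))}
    [IsProbabilityMeasure ν] (hν : MemLp id 2 ν) (v : EuclideanSpace ℝ (Fin d)) :
    covarianceBilin ν v v ≤ lambdaMax (covMat ν) * ‖v‖ ^ 2 := by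
  have hA : (covMat ν).IsHermitian := by
    ext p q
    simp [covMat, mul_comm]
  rw [covarianceBilin_eq_dotProduct hν, EuclideanSpace.real_norm_sq_eq]
  refine (dotProduct_mulVec_le_lambdaMax hA v.ofLp).trans_eq ?_
  simp [dotProduct, pow_two]

/-! ### The three forms of the majority relation -/

/-- The difference of squared distances is affine in the data point, so that its average over a
block is its value at the block mean. -/
theorem avg_norm_sub_sq_sub {d n k m : ℕ} (hm : 0 < m) {B : Fin k → Finset (Fin n)}
    (hB : IsBlockPartition m B) (x : Fin n → EuclideanSpace ℝ (Fin d))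
    (a b : EuclideanSpace ℝ (Fin d)) (j : Fin k) :
    (1 / (m : ℝ)) * ∑ i ∈ B j, (‖x i - b‖ ^ 2 - ‖x i - a‖ ^ 2) =
      ‖blockMean m B x j - b‖ ^ 2 - ‖blockMean m B x j - a‖ ^ 2 := by
  have hm' : (m : ℝ) ≠ 0 := by positivity
  have h : ∀ y : EuclideanSpace ℝ (Fin d),
      ‖y - b‖ ^ 2 - ‖y - a‖ ^ 2 = ⟪y, (2 : ℝ) • (a - b)⟫ + (‖b‖ ^ 2 - ‖a‖ ^ 2) := by
    intro y
    rw [norm_sub_sq_real, norm_sub_sq_real, inner_smul_right, inner_sub_right]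
    ring
  simp_rw [h]
  rw [Finset.sum_add_distrib, ← sum_inner, Finset.sum_const, hB.card_eq, nsmul_eq_mul, blockMean,
    real_inner_smul_left]
  field_simp

theorem closerToMajority_iff_defeats {d n k m : ℕ} (hm : 0 < m) {B : Fin k → Finset (Fin n)}
    (hB : IsBlockPartition m B) (x : Fin n → EuclideanSpace ℝ (Fin d))
    (a b : EuclideanSpace ℝ (Fin d)) :
    CloserToMajority (blockMean m B x) a b ↔ Defeats m B x a b := by
  simp only [CloserToMajority, Defeats, avg_norm_sub_sq_sub hm hB, sub_pos,
    sq_lt_sq₀ (norm_nonneg _) (norm_nonneg _)]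

theorem closerToMajority_iff_notMem_closerSet {d k : ℕ} (Z : Fin k → EuclideanSpace ℝ (Fin d))
    (a b : EuclideanSpace ℝ (Fin d)) :
    CloserToMajority Z a b ↔ b ∉ closerSet Z a := by
  classical
  have hcard : ((Finset.univ.filter fun j : Fin k => ‖Z j - a‖ < ‖Z j - b‖).card : ℝ) +
      ((Finset.univ.filter fun j : Fin k => ¬ ‖Z j - a‖ < ‖Z j - b‖).card : ℝ) = k := by
    exact_mod_cast (Finset.card_filter_add_card_filter_not _).trans (by simp)
  constructor
  · rintro h ⟨J, hJ, hJc⟩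
    have hle : (J.card : ℝ) ≤
        ((Finset.univ.filter fun j : Fin k => ¬ ‖Z j - a‖ < ‖Z j - b‖).card : ℝ) := by
      exact_mod_cast Finset.card_le_card fun j hj => by simpa using hJc j hj
    unfold CloserToMajority at h
    have h' : (k : ℝ) / 2 <
      ((Finset.univ.filter fun j : Fin k => ‖Z j - a‖ < ‖Z j - b‖).card : ℝ) := by convert h
    linarith
  · intro h
    by_contra hc
    have hc' : ¬ (k : ℝ) / 2 <
      ((Finset.univ.filter fun j : Fin k => ‖Z j - a‖ < ‖Z j - b‖).card : ℝ) := by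
        intro h'
        apply hc
        unfold CloserToMajority
        convert h'
    exact h ⟨Finset.univ.filter fun j : Fin k => ¬ ‖Z j - a‖ < ‖Z j - b‖, by linarith,
      fun j hj => by simpa using hj⟩

/-- The geometric reduction: a point at distance at least `r` from `μ` loses to `μ` as soon as fewer
than half of the `Z j - μ` have a component of at least `r / 2` in its direction. -/
theorem closerToMajority_of_card {d k : ℕ} (Z : Fin k → EuclideanSpace ℝ (Fin d))
    (μ a : EuclideanSpace ℝ (Fin d)) {r : ℝ} (ha : a ≠ μ) (hr : r ≤ ‖a - μ‖)
    (h : exceedances (fun j => Z j - μ) (r / 2) (‖a - μ‖⁻¹ • (a - μ)) < k / 2) :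
    CloserToMajority Z μ a := by
  classical
  have hpos : 0 < ‖a - μ‖ := norm_pos_iff.2 (sub_ne_zero.2 ha)
  rw [closerToMajority_iff_notMem_closerSet]
  rintro ⟨J, hJ, hJc⟩
  rw [exceedances, Finset.sum_boole] at h
  refine absurd (hJ.trans ?_) h.not_ge
  refine Nat.cast_le.2 (Finset.card_le_card fun j hj => ?_)
  have h1 : ‖Z j - a‖ ^ 2 ≤ ‖Z j - μ‖ ^ 2 := by
    gcongr
    exact hJc j hj
  have h2 : Z j - a = (Z j - μ) - (a - μ) := by abel
  rw [h2, norm_sub_sq_real] at h1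
  simp only [Finset.mem_filter, Finset.mem_univ, true_and]
  rw [inner_smul_right, inv_mul_eq_div, le_div_iff₀ hpos]
  nlinarith

end MomTournament

/-! ### Functions of disjoint blocks of coordinates -/

/-- Under a product measure, functions of disjoint sets of coordinates are independent. -/
theorem indepFun_pi_of_dependsOn {ι α : Type*} [Fintype ι] [MeasurableSpace α] (ν : Measure α)
    [IsProbabilityMeasure ν] {f g : (ι → α) → ℝ} (hf : Measurable f) (hg : Measurable g)
    {S T : Finset ι} (hST : Disjoint S T) (hfS : DependsOn f S) (hgT : DependsOn g T) :
    IndepFun f g (Measure.pi fun _ : ι => ν) := by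
  classical
  obtain ⟨x₀⟩ : Nonempty α := nonempty_of_isProbabilityMeasure ν
  have hind : iIndepFun (fun i (x : ι → α) => x i) (Measure.pi fun _ : ι => ν) :=
    iIndepFun_pi (X := fun _ => id) fun _ => aemeasurable_id
  have h := hind.indepFun_finset S T hST fun i => measurable_pi_apply i
  -- `F` is a function of the coordinates in `U`, the others being frozen at `x₀`.
  have key : ∀ {F : (ι → α) → ℝ} {U : Finset ι}, DependsOn F U →
      F = (fun y : U → α => F fun i => if hi : i ∈ U then y ⟨i, hi⟩ else x₀) ∘
        fun x i => x i := by
    intro F U hF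
    funext x
    refine hF fun i hi => ?_
    simp [Finset.mem_coe.1 hi]
  have hmeas : ∀ {F : (ι → α) → ℝ} (U : Finset ι), Measurable F →
      Measurable fun y : U → α => F fun i => if hi : i ∈ U then y ⟨i, hi⟩ else x₀ := by
    intro F U hF
    refine hF.comp (measurable_pi_lambda _ fun i => ?_)
    by_cases hi : i ∈ U
    · simpa [hi] using measurable_pi_apply _
    · simp [hi]
  rw [key hfS, key hgT]
  exact h.comp (hmeas S hf) (hmeas T hg)

theorem integral_prod_eq_prod_integral_of_dependsOn {ι κ α : Type*} [Fintype ι]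
    [MeasurableSpace α] (ν : Measure α) [IsProbabilityMeasure ν] {F : κ → (ι → α) → ℝ}
    (hF : ∀ j, Measurable (F j)) {B : κ → Finset ι} (hB : Pairwise fun i j => Disjoint (B i) (B j))
    (hdep : ∀ j, DependsOn (F j) (B j)) (s : Finset κ) :
    ∫ x, ∏ j ∈ s, F j x ∂(Measure.pi fun _ : ι => ν) =
      ∏ j ∈ s, ∫ x, F j x ∂(Measure.pi fun _ : ι => ν) := by
  classical
  induction s using Finset.induction_on with
  | empty => simp
  | insert a s ha ih =>
    simp_rw [Finset.prod_insert ha, ← ih]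
    have hmeas : Measurable fun x => ∏ j ∈ s, F j x :=
      Finset.measurable_fun_prod _ fun j _ => hF j
    have hdep' : DependsOn (fun x => ∏ j ∈ s, F j x) (s.biUnion B : Finset ι) := by
      intro x y hxy
      refine Finset.prod_congr rfl fun j hj => hdep j fun i hi => hxy i ?_
      exact Finset.mem_coe.2 (Finset.mem_biUnion.2 ⟨j, hj, hi⟩)
    have hdisj : Disjoint (B a) (s.biUnion B) := by
      rw [Finset.disjoint_biUnion_right]
      exact fun j hj => hB (ne_of_mem_of_not_mem hj ha).symm
    exact (indepFun_pi_of_dependsOn ν (hF a) hmeas hdisj (hdep a) hdep').integral_fun_mul_eq_mul_integral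
      (hF a).aestronglyMeasurable hmeas.aestronglyMeasurable

namespace MomTournament

/-! ### Exponential moment of the number of exceedances -/

theorem measurable_blockMean {d n k m : ℕ} (B : Fin k → Finset (Fin n)) (j : Fin k) :
    Measurable fun x : Fin n → EuclideanSpace ℝ (Fin d) => blockMean m B x j := by
  unfold blockMean
  fun_prop

theorem dependsOn_blockMean {d n k m : ℕ} (B : Fin k → Finset (Fin n)) (j : Fin k) :
    DependsOn (fun x : Fin n → EuclideanSpace ℝ (Fin d) => blockMean m B x j) (B j) := by
  intro x y h
  simp only [blockMean]
  rw [Finset.sum_congr rfl fun i hi => h i hi]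

/-- Chebyshev's inequality for one block mean, whose variance along `θ` is that of `ν` divided
by `m`. -/
theorem measureReal_inner_blockMean_le
    {d n k m : ℕ} (hm : 0 < m) {B : Fin k → Finset (Fin n)} (hB : IsBlockPartition m B)
    {ν : Measure (EuclideanSpace ℝ (Fin d))} [IsProbabilityMeasure ν] (hν : MemLp id 2 ν)
    (θ : EuclideanSpace ℝ (Fin d)) {ρ : ℝ} (hρ : 0 < ρ)
    (j : Fin k) :
    (Measure.pi fun _ : Fin n => ν).real {x | ρ ≤ ⟪blockMean m B x j - meanVec ν, θ⟫} ≤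
      covarianceBilin ν θ θ / (m * ρ ^ 2) := by
  set π := Measure.pi fun _ : Fin n => ν
  have hm' : (m : ℝ) ≠ 0 := by positivity
  have hmp : ∀ i, MeasurePreserving (fun x : Fin n → EuclideanSpace ℝ (Fin d) => x i) π ν :=
    fun i => measurePreserving_eval _ i
  have hL1 : MemLp (fun y : EuclideanSpace ℝ (Fin d) => ⟪θ, y⟫) 2 ν := hν.const_inner θ
  have hL : ∀ i, MemLp (fun x : Fin n → EuclideanSpace ℝ (Fin d) => ⟪θ, x i⟫) 2 π :=
    fun i => hL1.comp_measurePreserving (hmp i)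
  have hsum : MemLp (∑ i ∈ B j, fun x : Fin n → EuclideanSpace ℝ (Fin d) => ⟪θ, x i⟫) 2 π :=
    memLp_finsetSum' _ fun i _ => hL i
  set Y : (Fin n → EuclideanSpace ℝ (Fin d)) → ℝ := fun x => ⟪θ, blockMean m B x j⟫
  have hY : Y = fun x => (1 / (m : ℝ)) *
      (∑ i ∈ B j, fun x : Fin n → EuclideanSpace ℝ (Fin d) => ⟪θ, x i⟫) x := by
    funext x
    simp [Y, blockMean, inner_smul_right, inner_sum]
  have hYL : MemLp Y 2 π := by
    rw [hY]
    exact hsum.const_mul _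
  have hind : iIndepFun (fun i (x : Fin n → EuclideanSpace ℝ (Fin d)) => ⟪θ, x i⟫) π :=
    iIndepFun_pi (X := fun _ y => ⟪θ, y⟫) fun _ => by fun_prop
  have hvar1 : ∀ i, Var[fun x : Fin n → EuclideanSpace ℝ (Fin d) => ⟪θ, x i⟫; π] =
      covarianceBilin ν θ θ := by
    intro i
    rw [covarianceBilin_self hν, ← (hmp i).map_eq,
      variance_map (by fun_prop) (hmp i).aemeasurable]
    rfl
  have hint1 : ∀ i, ∫ x, ⟪θ, x i⟫ ∂π = ⟪θ, meanVec ν⟫ := by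
    intro i
    have h := integral_inner (𝕜 := ℝ) (hν.integrable (by norm_num)) θ
    simp only [id] at h
    rw [meanVec, ← h, ← (hmp i).map_eq, integral_map (hmp i).aemeasurable (by fun_prop)]
  have hvar : Var[Y; π] = covarianceBilin ν θ θ / m := by
    rw [hY, variance_const_mul, IndepFun.variance_sum (fun i _ => hL i)
      (fun i _ i' _ hii => hind.indepFun hii)]
    simp only [hvar1, Finset.sum_const, hB.card_eq, nsmul_eq_mul]
    field_simp
  have hmean : π[Y] = ⟪θ, meanVec ν⟫ := by
    rw [hY]
    simp only [Finset.sum_apply]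
    rw [integral_const_mul, integral_finsetSum _ fun i _ => (hL i).integrable (by norm_num)]
    simp only [hint1, Finset.sum_const, hB.card_eq, nsmul_eq_mul]
    field_simp
  have hcheb := meas_ge_le_variance_div_sq hYL hρ
  have hnn : 0 ≤ Var[Y; π] / ρ ^ 2 := div_nonneg (variance_nonneg _ _) (by positivity)
  have h1 : π.real {x | ρ ≤ |Y x - π[Y]|} ≤ Var[Y; π] / ρ ^ 2 :=
    ENNReal.toReal_le_of_le_ofReal hnn hcheb
  refine (measureReal_mono fun x hx => ?_).trans (h1.trans_eq ?_)
  · simp only [Set.mem_ofPred_eq] at hx ⊢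
    rw [hmean, ← inner_sub_right, real_inner_comm]
    exact hx.trans (le_abs_self _)
  · rw [hvar]
    field_simp

/-- The blocks are independent, and for each of them the exponential moment of the indicator is
`1 + (e - 1) P ≤ exp (2 P)`, where `P` is bounded by Chebyshev's inequality. -/
theorem integral_exp_exceedances_le
    {d n k m : ℕ} (hm : 0 < m) {B : Fin k → Finset (Fin n)} (hB : IsBlockPartition m B)
    {ν : Measure (EuclideanSpace ℝ (Fin d))} [IsProbabilityMeasure ν] (hν : MemLp id 2 ν)
    (θ : EuclideanSpace ℝ (Fin d)) {ρ : ℝ} (hρ : 0 < ρ) :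
    ∫ x, Real.exp (exceedances (fun j => blockMean m B x j - meanVec ν) ρ θ)
        ∂(Measure.pi fun _ : Fin n => ν) ≤
      Real.exp (2 * k * (covarianceBilin ν θ θ / (m * ρ ^ 2))) := by
  set π := Measure.pi fun _ : Fin n => ν
  set p := covarianceBilin ν θ θ / (m * ρ ^ 2)
  have hms : ∀ j, MeasurableSet {x : Fin n → EuclideanSpace ℝ (Fin d) |
      ρ ≤ ⟪blockMean m B x j - meanVec ν, θ⟫} := by
    intro j
    have := measurable_blockMean (d := d) (m := m) B j
    exact measurableSet_le (by fun_prop) (by fun_prop)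
  have hFm : ∀ j, Measurable fun x : Fin n → EuclideanSpace ℝ (Fin d) =>
      Real.exp (if ρ ≤ ⟪blockMean m B x j - meanVec ν, θ⟫ then (1 : ℝ) else 0) :=
    fun j => (Measurable.ite (hms j) measurable_const measurable_const).exp
  simp_rw [exceedances, Real.exp_sum]
  rw [integral_prod_eq_prod_integral_of_dependsOn ν hFm hB.disjoint]
  · have hj : ∀ j, ∫ x, Real.exp (if ρ ≤ ⟪blockMean m B x j - meanVec ν, θ⟫ then (1 : ℝ) else 0)
        ∂π ≤ Real.exp (2 * p) := by
      intro j
      have he : ∀ x : Fin n → EuclideanSpace ℝ (Fin d),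
          Real.exp (if ρ ≤ ⟪blockMean m B x j - meanVec ν, θ⟫ then (1 : ℝ) else 0) =
          1 + Set.indicator {x | ρ ≤ ⟪blockMean m B x j - meanVec ν, θ⟫}
            (fun _ => Real.exp 1 - 1) x := by
        intro x
        by_cases hx : ρ ≤ ⟪blockMean m B x j - meanVec ν, θ⟫ <;> simp [hx]
      simp_rw [he]
      rw [integral_add (integrable_const _) ((integrable_const _).indicator (hms j)),
        integral_indicator_const _ (hms j)]
      have hp := measureReal_inner_blockMean_le hm hB hν θ hρ j
      have hp0 : 0 ≤ π.real {x | ρ ≤ ⟪blockMean m B x j - meanVec ν, θ⟫} := measureReal_nonneg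
      have hexp : Real.exp 1 - 1 ≤ 2 := by linarith [Real.exp_one_lt_d9]
      have h2 := Real.add_one_le_exp (2 * p)
      simp only [integral_const, probReal_univ, smul_eq_mul]
      nlinarith
    calc ∏ j : Fin k, ∫ x, Real.exp (if ρ ≤ ⟪blockMean m B x j - meanVec ν, θ⟫ then (1 : ℝ) else 0)
          ∂π ≤ ∏ _j : Fin k, Real.exp (2 * p) :=
          Finset.prod_le_prod (fun j _ => integral_nonneg fun x => Real.exp_nonneg _)
            fun j _ => hj j
      _ = Real.exp (2 * k * p) := by
        rw [Finset.prod_const, Finset.card_univ, Fintype.card_fin, ← Real.exp_nat_mul]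
        congr 1
        ring
  · intro j x y hxy
    have := dependsOn_blockMean (d := d) (m := m) B j hxy
    simp only at this ⊢
    rw [this]

/-! ### A bound on the exceedances uniform in the direction -/

theorem exceedances_nonneg {d k : ℕ} (U : Fin k → EuclideanSpace ℝ (Fin d)) (ρ : ℝ)
    (θ : EuclideanSpace ℝ (Fin d)) : 0 ≤ exceedances U ρ θ :=
  Finset.sum_nonneg fun j _ => by split_ifs <;> norm_num

theorem exceedances_le {d k : ℕ} (U : Fin k → EuclideanSpace ℝ (Fin d)) (ρ : ℝ)
    (θ : EuclideanSpace ℝ (Fin d)) : exceedances U ρ θ ≤ k := by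
  refine (Finset.sum_le_card_nsmul _ _ 1 fun j _ => ?_).trans_eq (by simp)
  split_ifs <;> norm_num

theorem exceedances_smul {d k : ℕ} (U : Fin k → EuclideanSpace ℝ (Fin d)) (ρ : ℝ)
    (θ : EuclideanSpace ℝ (Fin d)) {c : ℝ} (hc : 0 < c) :
    exceedances U (c * ρ) (c • θ) = exceedances U ρ θ := by
  simp only [exceedances, inner_smul_right, mul_le_mul_iff_right₀ hc]

theorem measurable_exceedances {α : Type*} [MeasurableSpace α] {d k : ℕ}
    {U : Fin k → α → EuclideanSpace ℝ (Fin d)} (hU : ∀ j, Measurable (U j)) (ρ : ℝ)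
    {θ : α → EuclideanSpace ℝ (Fin d)} (hθ : Measurable θ) :
    Measurable fun x => exceedances (fun j => U j x) ρ (θ x) := by
  refine Finset.measurable_fun_sum _ fun j _ => Measurable.ite ?_ measurable_const measurable_const
  have := hU j
  exact measurableSet_le (by fun_prop) (by fun_prop)

theorem integrable_exceedances_add_left {d k : ℕ} (U : Fin k → EuclideanSpace ℝ (Fin d)) (ρ : ℝ)
    (v : EuclideanSpace ℝ (Fin d)) :
    Integrable (fun x => exceedances U ρ (v + x)) (stdGaussian (EuclideanSpace ℝ (Fin d))) := by
  refine Integrable.of_bound (C := k)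
    (measurable_exceedances (fun j => measurable_const) ρ (by fun_prop)).aestronglyMeasurable
    (.of_forall fun x => ?_)
  rw [Real.norm_of_nonneg (exceedances_nonneg _ _ _)]
  exact exceedances_le _ _ _

/-- If `U j` exceeds `ρ` along `v`, it does so along `v + ξ` whenever `⟪U j, ξ⟫ ≥ 0`, which has
Gaussian probability at least one half. This makes smoothing by Gaussian noise free of any bound on
the norms of the `U j`. -/
theorem exceedances_le_two_mul_integral_add_left {d k : ℕ}
    (U : Fin k → EuclideanSpace ℝ (Fin d)) (ρ : ℝ) (v : EuclideanSpace ℝ (Fin d)) :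
    exceedances U ρ v ≤
      2 * ∫ x, exceedances U ρ (v + x) ∂(stdGaussian (EuclideanSpace ℝ (Fin d))) := by
  set γ := stdGaussian (EuclideanSpace ℝ (Fin d))
  have hms : ∀ j, MeasurableSet {x | ρ ≤ ⟪U j, v + x⟫} := fun j =>
    measurableSet_le (by fun_prop) (by fun_prop)
  have hind : ∀ j, (fun x => if ρ ≤ ⟪U j, v + x⟫ then (1 : ℝ) else 0) =
      Set.indicator {x | ρ ≤ ⟪U j, v + x⟫} (fun _ => 1) := by
    intro j
    funext x
    simp [Set.indicator_apply]
  simp only [exceedances]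
  rw [integral_finsetSum _ fun j _ => by
    rw [hind]; exact (integrable_const _).indicator (hms j), Finset.mul_sum]
  refine Finset.sum_le_sum fun j _ => ?_
  rw [hind, integral_indicator_const _ (hms j), smul_eq_mul, mul_one]
  split_ifs with h
  · have h1 := half_le_stdGaussian_halfSpace (U j)
    have h2 : γ.real {x | 0 ≤ ⟪U j, x⟫} ≤ γ.real {x | ρ ≤ ⟪U j, v + x⟫} := by
      refine measureReal_mono fun x hx => ?_
      simp only [Set.mem_ofPred_eq, inner_add_right] at hx ⊢
      linarith
    linarith
  · positivity

/-- A single event of probability `1 - δ` bounds the number of exceedances along all `v`. The event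
concerns one Gaussian mixture of exponential moments, so no supremum over `v` has to be measured. -/
theorem exists_measurableSet_forall_exceedances_lt {d n k m : ℕ} (hm : 0 < m)
    {B : Fin k → Finset (Fin n)} (hB : IsBlockPartition m B)
    {ν : Measure (EuclideanSpace ℝ (Fin d))} [IsProbabilityMeasure ν] (hν : MemLp id 2 ν)
    {δ : ℝ} (hδ : 0 < δ) {ρ : ℝ} (hρ : 0 < ρ) :
    ∃ S : Set (Fin n → EuclideanSpace ℝ (Fin d)), MeasurableSet S ∧
      1 - δ ≤ (Measure.pi fun _ : Fin n => ν).real S ∧ ∀ x ∈ S, ∀ v,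
        exceedances (fun j => blockMean m B x j - meanVec ν) ρ v / 2 <
          2 * k * ((covarianceBilin ν v v + (covMat ν).trace) / (m * ρ ^ 2)) +
            ‖v‖ ^ 2 / 2 + Real.log (1 / δ) := by
  set π := Measure.pi fun _ : Fin n => ν
  set γ := stdGaussian (EuclideanSpace ℝ (Fin d))
  set N : (Fin n → EuclideanSpace ℝ (Fin d)) → EuclideanSpace ℝ (Fin d) → ℝ :=
    fun x θ => exceedances (fun j => blockMean m B x j - meanVec ν) ρ θ with hN
  set p : EuclideanSpace ℝ (Fin d) → ℝ :=
    fun θ => 2 * k * (covarianceBilin ν θ θ / (m * ρ ^ 2)) with hp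
  have hp0 : ∀ θ, 0 ≤ p θ := fun θ => by
    have := covarianceBilin_self_nonneg (μ := ν) θ
    positivity
  have hpm : Measurable p := by
    have : Continuous p := by fun_prop
    exact this.measurable
  have hNm : Measurable fun z : (Fin n → EuclideanSpace ℝ (Fin d)) × EuclideanSpace ℝ (Fin d) =>
      N z.1 z.2 := by
    refine measurable_exceedances (fun j => ?_) ρ measurable_snd
    exact ((measurable_blockMean B j).comp measurable_fst).sub_const _
  have hGm : Measurable fun z : (Fin n → EuclideanSpace ℝ (Fin d)) × EuclideanSpace ℝ (Fin d) =>
      Real.exp (N z.1 z.2 - p z.2) := (hNm.sub (hpm.comp measurable_snd)).exp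
  have hGb : ∀ x θ, ‖Real.exp (N x θ - p θ)‖ ≤ Real.exp k := by
    intro x θ
    rw [Real.norm_of_nonneg (Real.exp_nonneg _)]
    refine Real.exp_le_exp.2 ?_
    have := exceedances_le (fun j => blockMean m B x j - meanVec ν) ρ θ
    have := hp0 θ
    simp only [hN]
    linarith
  have hGint : Integrable (fun z : (Fin n → EuclideanSpace ℝ (Fin d)) ×
      EuclideanSpace ℝ (Fin d) => Real.exp (N z.1 z.2 - p z.2)) (π.prod γ) :=
    Integrable.of_bound hGm.aestronglyMeasurable (Real.exp k) (.of_forall fun z => hGb z.1 z.2)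
  set W : (Fin n → EuclideanSpace ℝ (Fin d)) → ℝ := fun x => ∫ θ, Real.exp (N x θ - p θ) ∂γ with hW
  have hWm : Measurable W :=
    (hGm.stronglyMeasurable.integral_prod_right (ν := γ)).measurable
  have hWint : Integrable W π := hGint.integral_prod_left
  have hW1 : ∫ x, W x ∂π ≤ 1 := by
    rw [integral_integral_swap (f := fun x θ => Real.exp (N x θ - p θ)) hGint]
    have hle : ∀ θ, ∫ x, Real.exp (N x θ - p θ) ∂π ≤ 1 := by
      intro θ
      simp_rw [Real.exp_sub]
      rw [integral_div]
      exact (div_le_one (Real.exp_pos _)).2 (integral_exp_exceedances_le hm hB hν θ hρ)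
    refine (integral_mono hGint.integral_prod_right (integrable_const (1 : ℝ)) hle).trans_eq ?_
    simp
  refine ⟨{x | W x < 1 / δ}, measurableSet_lt hWm measurable_const, ?_, fun x hx v => ?_⟩
  · have hmk := mul_meas_ge_le_integral_of_nonneg (μ := π) (f := W)
      (.of_forall fun x => integral_nonneg fun θ => Real.exp_nonneg _) hWint (1 / δ)
    have hc : {x | W x < 1 / δ}ᶜ = {x | 1 / δ ≤ W x} := by
      ext x
      simp
    have hadd := probReal_add_probReal_compl (μ := π)
      (measurableSet_lt hWm (measurable_const (a := 1 / δ)))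
    rw [hc] at hadd
    have : π.real {x | 1 / δ ≤ W x} ≤ δ := by
      have := hmk.trans hW1
      rwa [one_div_mul_eq_div, div_le_iff₀ hδ, one_mul] at this
    linarith
  · have hNi := integrable_exceedances_add_left (fun j => blockMean m B x j - meanVec ν) ρ v
    obtain ⟨hMi, hMe⟩ := integrable_and_integral_bilin_add_left_stdGaussian (covarianceBilin ν) v
    have hpi : Integrable (fun θ => p (v + θ)) γ := (hMi.div_const _).const_mul _
    have hexp : Integrable (fun θ => Real.exp (N x θ - p θ)) γ :=
      Integrable.of_bound (hGm.comp measurable_prodMk_left).aestronglyMeasurable (Real.exp k)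
        (.of_forall fun θ => hGb x θ)
    have hJ := exp_integral_comp_add_sub_le_integral_exp (h := fun θ => N x θ - p θ) v hexp
      (hNi.sub hpi)
    have hlt := hJ.trans_lt hx
    rw [← Real.lt_log_iff_exp_lt (by positivity), integral_sub hNi hpi] at hlt
    have hpe : ∫ θ, p (v + θ) ∂γ =
        2 * k * ((covarianceBilin ν v v + (covMat ν).trace) / (m * ρ ^ 2)) := by
      simp only [hp]
      rw [integral_const_mul, integral_div, hMe, trace_covMat hν]
    rw [hpe] at hlt
    have h2 := exceedances_le_two_mul_integral_add_left
      (fun j => blockMean m B x j - meanVec ν) ρ v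
    linarith

/-! ### The tournament radius -/

theorem ae_eq_meanVec_of_trace_covMat_le {d : ℕ} {ν : Measure (EuclideanSpace ℝ (Fin d))}
    [IsProbabilityMeasure ν] (hν : MemLp id 2 ν) (h : (covMat ν).trace ≤ 0) :
    ∀ᵐ x ∂ν, x = meanVec ν := by
  have hnn : ∀ p, 0 ≤ covMat ν p p := fun p => integral_nonneg fun x => mul_self_nonneg _
  have hz := (Finset.sum_eq_zero_iff_of_nonneg fun p _ => hnn p).1
    (le_antisymm h (Finset.sum_nonneg fun p _ => hnn p))
  have hp : ∀ p, ∀ᵐ x ∂ν, x p = meanVec ν p := by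
    intro p
    have hL : MemLp (fun x : EuclideanSpace ℝ (Fin d) => x p - meanVec ν p) 2 ν := by
      have h1 : MemLp (fun x : EuclideanSpace ℝ (Fin d) => x p) 2 ν :=
        (hν.const_inner (EuclideanSpace.basisFun (Fin d) ℝ p)).ae_eq
          (.of_forall fun x => by simp [EuclideanSpace.inner_single_left])
      exact h1.sub (memLp_const _)
    have h0 := (integral_eq_zero_iff_of_nonneg (fun x => mul_self_nonneg _)
      (hL.integrable_mul hL)).1 (hz p (Finset.mem_univ p))
    filter_upwards [h0] with x hx
    exact sub_eq_zero.1 (mul_self_eq_zero.1 hx)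
  filter_upwards [ae_all_iff.2 hp] with x hx
  ext p
  exact hx p

theorem blockMean_const {d n k m : ℕ} (hm : 0 < m) {B : Fin k → Finset (Fin n)}
    (hB : IsBlockPartition m B) (c : EuclideanSpace ℝ (Fin d)) (j : Fin k) :
    blockMean m B (fun _ => c) j = c := by
  have hm' : (m : ℝ) ≠ 0 := by positivity
  rw [blockMean, Finset.sum_const, hB.card_eq, ← Nat.cast_smul_eq_nsmul ℝ, smul_smul,
    one_div_mul_cancel hm', one_smul]

/-- The probabilistic core of the theorem, on the canonical space of the data. -/
theorem exists_measurableSet_closerToMajority {d n k m : ℕ} {δ : ℝ} (hδ0 : 0 < δ) (hδ1 : δ < 1)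
    (hk : k = ⌈200 * Real.log (2 / δ)⌉₊) (hm : 0 < m) (hnm : n = m * k)
    {B : Fin k → Finset (Fin n)} (hB : IsBlockPartition m B)
    {ν : Measure (EuclideanSpace ℝ (Fin d))} [IsProbabilityMeasure ν] (hν : MemLp id 2 ν) :
    ∃ S : Set (Fin n → EuclideanSpace ℝ (Fin d)), MeasurableSet S ∧
      1 - δ ≤ (Measure.pi fun _ : Fin n => ν).real S ∧ ∀ x ∈ S, ∀ a, a ≠ meanVec ν →
        radius ν n δ ≤ ‖a - meanVec ν‖ → CloserToMajority (blockMean m B x) (meanVec ν) a := by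
  set L := Real.log (2 / δ) with hL
  have hm' : (0 : ℝ) < m := by positivity
  have hL2 : 1 / 2 < L := by
    have h1 : Real.log 2 ≤ L := Real.log_le_log (by norm_num) (by rw [le_div_iff₀ hδ0]; linarith)
    linarith [Real.log_two_gt_d9]
  have hLδ : Real.log (1 / δ) ≤ L :=
    Real.log_le_log (by positivity) (by gcongr; norm_num)
  have hkL : 200 * L ≤ k := by rw [hk]; exact Nat.le_ceil _
  have hkU : (k : ℝ) ≤ 202 * L := by
    have := Nat.ceil_lt_add_one (a := 200 * L) (by linarith)
    rw [← hk] at this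
    linarith
  have hk0 : (0 : ℝ) < k := by linarith
  have hn : (n : ℝ) = m * k := by rw [hnm]; push_cast; rfl
  have hn0 : (0 : ℝ) < n := by rw [hn]; positivity
  set r := radius ν n δ with hr
  have hr0 : 0 ≤ r := le_max_of_le_left (by positivity)
  have hrT : 921600 * (covMat ν).trace ≤ m * k * r ^ 2 := by
    have h1 : 960 * √((covMat ν).trace / n) ≤ r := le_max_left _ _
    have h2 : √((covMat ν).trace / n) ≤ r / 960 := by linarith
    have h3 := (Real.sqrt_le_left (by positivity)).1 h2
    rw [div_le_iff₀ hn0, hn] at h3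
    linarith
  have hrL : 57600 * (lambdaMax (covMat ν) * L) ≤ m * k * r ^ 2 := by
    have h1 : 240 * √(lambdaMax (covMat ν) * L / n) ≤ r := le_max_right _ _
    have h2 : √(lambdaMax (covMat ν) * L / n) ≤ r / 240 := by linarith
    have h3 := (Real.sqrt_le_left (by positivity)).1 h2
    rw [div_le_iff₀ hn0, hn] at h3
    linarith
  -- If `r = 0` the law is a Dirac mass; the bound below needs a positive threshold `ρ`.
  rcases hr0.eq_or_lt with hr0 | hr0
  · have hT : (covMat ν).trace ≤ 0 := by
      rw [← hr0] at hrT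
      linarith
    have hae : ∀ᵐ x ∂(Measure.pi fun _ : Fin n => ν), ∀ i, x i = meanVec ν :=
      ae_all_iff.2 fun i => (measurePreserving_eval (fun _ : Fin n => ν) i).quasiMeasurePreserving.ae
        (ae_eq_meanVec_of_trace_covMat_le hν hT)
    refine ⟨{fun _ => meanVec ν}, measurableSet_singleton _, ?_, ?_⟩
    · have h1 : (Measure.pi fun _ : Fin n => ν) {fun _ => meanVec ν} = 1 := by
        rw [← mem_ae_iff_prob_eq_one (measurableSet_singleton _)]
        filter_upwards [hae] with x hx
        exact funext hx
      rw [measureReal_def, h1]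
      simp only [ENNReal.toReal_one]
      linarith
    · rintro _ rfl a ha -
      refine closerToMajority_of_card (r := ‖a - meanVec ν‖) _ _ _ ha le_rfl ?_
      have hpos : 0 < ‖a - meanVec ν‖ := norm_pos_iff.2 (sub_ne_zero.2 ha)
      simp only [exceedances, blockMean_const hm hB, sub_self, inner_zero_left,
        (half_pos hpos).not_ge, if_false, Finset.sum_const_zero]
      positivity
  · -- Rescaling a unit vector by `s` balances the entropy cost `s ^ 2 / 2 = k / 20` against the
    -- contribution of the trace, which is proportional to `1 / s ^ 2`.
    set s := √((k : ℝ) / 10) with hs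
    have hs0 : 0 < s := Real.sqrt_pos.2 (by positivity)
    have hs2 : s ^ 2 = k / 10 := Real.sq_sqrt (by positivity)
    obtain ⟨S, hSm, hSp, hS⟩ := exists_measurableSet_forall_exceedances_lt hm hB hν hδ0
      (ρ := s * (r / 2)) (by positivity)
    refine ⟨S, hSm, hSp, fun x hx a ha har => closerToMajority_of_card _ _ _ ha har ?_⟩
    have hpos : 0 < ‖a - meanVec ν‖ := norm_pos_iff.2 (sub_ne_zero.2 ha)
    set v := ‖a - meanVec ν‖⁻¹ • (a - meanVec ν) with hv
    have hv1 : ‖v‖ = 1 := by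
      rw [hv, norm_smul, norm_inv, norm_norm, inv_mul_cancel₀ hpos.ne']
    have h := hS x hx (s • v)
    rw [exceedances_smul _ _ _ hs0, norm_smul, hv1, mul_one, Real.norm_of_nonneg hs0.le, hs2] at h
    simp only [map_smul, smul_apply, smul_eq_mul] at h
    have hlam := covarianceBilin_self_le_lambdaMax hν v
    rw [hv1, one_pow, mul_one] at hlam
    -- The total is at most `k / 10 + k / 20 + k / 200`, below `k / 4`.
    have hb : 2 * k * ((s * (s * covarianceBilin ν v v) + (covMat ν).trace) /
        (m * (s * (r / 2)) ^ 2)) ≤ k / 10 := by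
      have e1 : m * (s * (r / 2)) ^ 2 = m * k * r ^ 2 / 40 := by
        rw [mul_pow, hs2]
        ring
      have e2 : s * (s * covarianceBilin ν v v) = k / 10 * covarianceBilin ν v v := by
        rw [← mul_assoc, ← pow_two, hs2]
      have h1 : k * covarianceBilin ν v v ≤ 202 * (lambdaMax (covMat ν) * L) := by
        have h0 := covarianceBilin_self_nonneg (μ := ν) v
        nlinarith
      rw [e1, e2, mul_div_assoc', div_le_iff₀ (by positivity)]
      have hR : 0 ≤ m * k * r ^ 2 := by positivity
      have : k * (k / 10 * covarianceBilin ν v v + (covMat ν).trace) ≤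
          k * (m * k * r ^ 2 / 800) := by
        gcongr
        linarith
      linarith
    linarith

end MomTournament

theorem theorem3p3 {Ω : Type*} [MeasurableSpace Ω] (P : Measure Ω) [IsProbabilityMeasure P]
    (d n k m : ℕ) (δ : ℝ) (hδ0 : 0 < δ) (hδ1 : δ < 1)
    (hk : k = ⌈200 * Real.log (2 / δ)⌉₊) (hn : 0 < n) (hnm : n = m * k)
    (B : Fin k → Finset (Fin n)) (hB : MomTournament.IsBlockPartition m B)
    (ν : Measure (EuclideanSpace ℝ (Fin d))) (hν : MemLp id 2 ν)
    (X : Fin n → Ω → EuclideanSpace ℝ (Fin d))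
    (hlaw : ∀ i, HasLaw (X i) ν P) (hindep : iIndepFun X P) :
    (∃ E : Set Ω, MeasurableSet E ∧ 1 - δ ≤ P.real E ∧
      ∀ ω ∈ E, ∀ a : EuclideanSpace ℝ (Fin d), a ≠ MomTournament.meanVec ν →
        MomTournament.radius ν n δ ≤ ‖a - MomTournament.meanVec ν‖ →
          MomTournament.CloserToMajority
              (MomTournament.blockMean m B fun i => X i ω) (MomTournament.meanVec ν) a ∧
            MomTournament.Defeats m B (fun i => X i ω) (MomTournament.meanVec ν) a ∧
            a ∉ MomTournament.closerSet
              (MomTournament.blockMean m B fun i => X i ω) (MomTournament.meanVec ν)) ∧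
    (∀ ω : Ω, ∀ a : EuclideanSpace ℝ (Fin d),
      (MomTournament.CloserToMajority
          (MomTournament.blockMean m B fun i => X i ω) (MomTournament.meanVec ν) a ↔
        MomTournament.Defeats m B (fun i => X i ω) (MomTournament.meanVec ν) a) ∧
      (MomTournament.CloserToMajority
          (MomTournament.blockMean m B fun i => X i ω) (MomTournament.meanVec ν) a ↔
        a ∉ MomTournament.closerSet
          (MomTournament.blockMean m B fun i => X i ω) (MomTournament.meanVec ν))) := by
  have hm : 0 < m := Nat.pos_of_ne_zero fun h => by simp [h] at hnm; omega
  have := (hlaw ⟨0, hn⟩).isProbabilityMeasure_iff.1 inferInstance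
  have hX : HasLaw (fun ω i => X i ω) (Measure.pi fun _ : Fin n => ν) P :=
    hindep.hasLaw_pi hlaw
  have hequiv : ∀ (ω : Ω) (a : EuclideanSpace ℝ (Fin d)), _ ∧ _ := fun ω a =>
    ⟨MomTournament.closerToMajority_iff_defeats hm hB (fun i => X i ω)
        (MomTournament.meanVec ν) a,
      MomTournament.closerToMajority_iff_notMem_closerSet
        (MomTournament.blockMean m B fun i => X i ω) (MomTournament.meanVec ν) a⟩
  refine ⟨?_, hequiv⟩
  obtain ⟨S, hSm, hSp, hS⟩ :=
    MomTournament.exists_measurableSet_closerToMajority hδ0 hδ1 hk hm hnm hB hν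
  -- The `X i` are only a.e. measurable, so the event is shrunk to a measurable one.
  obtain ⟨E, hES, hEm, hEae⟩ :=
    (hX.aemeasurable.nullMeasurableSet_preimage hSm).exists_measurable_subset_ae_eq
  refine ⟨E, hEm, ?_, fun ω hω a ha har => ?_⟩
  · rwa [measureReal_congr hEae, measureReal_def, ← Measure.map_apply_of_aemeasurable
      hX.aemeasurable hSm, hX.map_eq, ← measureReal_def]
  · have h := hS _ (hES hω) a ha har
    exact ⟨h, (hequiv ω a).1.1 h, (hequiv ω a).2.1 h⟩
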